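/- Let $N\in\mathbb N$, let $H$ be a separable complex Hilbert space and let $(G_x)_{x\in\mathbb R^N}$ be a family of closed subspaces of $H$ whose orthogonal projections $P_x:=P_{G_x}$ form a strongly measurable family, i.e. $x\mapsto P_xv$ is (a.e. strongly) measurable for every $v\in H$; this is the case in particular if $x\mapsto P_x\in\mathcal L(H)$ is of class $H^1$ or $H^1_{loc}$. Let $\mathcal G=\{f\in L^2(\mathbb R^N;H): f(x)\in G_x\text{ for a.e. }x\}$, a closed subspace of $L^2(\mathbb R^N;H)$, let $\mathcal P_{\mathcal G}$ be the orthogonal projection of $L^2(\mathbb R^N;H)$ onto $\mathcal G$, and let $(e^{is\mathcal P_{\mathcal G}})_{s\in\mathbb R}$ be the unitary group it generates. Let $$a(f)=\int_{\mathbb R^N}\|\nabla f(x)\|_{H^N}^2\,dx,\qquad f\in H^1(\mathbb R^N;H),$$ be the quadratic form of the Laplacian. Suppose that this group is a symmetry of the system associated with the Laplacian, i.e. that for all $f\in H^1(\mathbb R^N;H)$ and all $s\in\mathbb R$ $$e^{is\mathcal P_{\mathcal G}}f\in H^1(\mathbb R^N;H)\quad\text{and}\quad a(e^{is\mathcal P_{\mathcal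 G}}f)=a(f).$$ Then $x\mapsto P_x$ is locally constant: there are pairwise disjoint open sets $\omega_0$, $\omega_\infty$ and $\omega_e$ ($e\in E$) in $\mathbb R^N$ whose union has a complement of Lebesgue measure zero, such that $P_x=0$ for a.e. $x\in\omega_0$, $P_x=\mathrm{Id}$ for a.e. $x\in\omega_\infty$, and for each $e\in E$ there is a closed subspace $K_e\ne\{0\},H$ of $H$ with $P_x=P_{K_e}$ for a.e. $x\in\omega_e$. Moreover, if $\mathcal K$ is a set of closed subspaces of $H$ with $G_x\in\mathcal K$ for a.e. $x$ (for instance all closed subspaces or, if $H$ is a Hilbert lattice and a.e. $G_x$ is a closed ideal, the closed ideals of $H$), then all the $K_e$ can be chosen in $\mathcal K$. -/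

import Mathlib

open MeasureTheory Filter Topology
open scoped ContDiff

noncomputable section

namespace LocalSymmetry

/-- `ℝ^N` with its Euclidean structure and Lebesgue measure. -/
abbrev Space (N : ℕ) : Type := EuclideanSpace ℝ (Fin N)

/-- The Bochner space `L²(ℝ^N; H)`. -/
abbrev L2 (N : ℕ) (H : Type*) [NormedAddCommGroup H] : Type _ :=
  Lp H 2 (volume : Measure (Space N))

section Projections

variable {K : Type*} [NormedAddCommGroup K] [InnerProductSpace ℂ K] [CompleteSpace K]

instance (G : ClosedSubmodule ℂ K) : CompleteSpace G.toSubmodule :=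
  G.isClosed.completeSpace_coe

/-- The orthogonal projection of a Hilbert space onto a closed subspace. -/
def proj (G : ClosedSubmodule ℂ K) : K →L[ℂ] K := G.toSubmodule.starProjection

theorem isSelfAdjoint_proj (G : ClosedSubmodule ℂ K) : IsSelfAdjoint (proj G) :=
  isSelfAdjoint_starProjection G.toSubmodule

/-- For an orthogonal projection `P`, the operator `e^{isP}` is unitary. -/
theorem exp_proj_mem_unitary (G : ClosedSubmodule ℂ K) (s : ℝ) :
    NormedSpace.exp ((Complex.I * (s : ℂ)) • proj G) ∈ unitary (K →L[ℂ] K) := by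
  have h : ((Complex.I * (s : ℂ)) • proj G) = Complex.I • ((s : ℂ) • proj G) := mul_smul _ _ _
  have hs : IsSelfAdjoint ((s : ℂ) • proj G) := by
    have : IsSelfAdjoint (s : ℂ) := Complex.conj_ofReal s
    exact this.smul (isSelfAdjoint_proj G)
  rw [h]
  have := (selfAdjoint.expUnitary (⟨_, hs⟩ : selfAdjoint (K →L[ℂ] K))).2
  rwa [selfAdjoint.expUnitary_coe] at this

/-- The one-parameter unitary group `(e^{isP})_{s ∈ ℝ}` generated by `iP`, where `P` is the
orthogonal projection onto `G`. -/
def expGroup (G : ClosedSubmodule ℂ K) : Multiplicative ℝ →* unitary (K →L[ℂ] K) where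
  toFun s := ⟨NormedSpace.exp ((Complex.I * (s.toAdd : ℂ)) • proj G),
    exp_proj_mem_unitary G s.toAdd⟩
  map_one' := by
    apply Subtype.ext
    simp
  map_mul' s t := by
    apply Subtype.ext
    simp only [toAdd_mul, Complex.ofReal_add, mul_add, add_smul, Submonoid.coe_mul]
    let _ : NormedAlgebra ℚ (K →L[ℂ] K) := NormedAlgebra.restrictScalars ℚ ℂ _
    exact NormedSpace.exp_add_of_commute
      (((Commute.refl (proj G)).smul_left _).smul_right _)

end Projections

/-- A group `O` of unitary operators on a Hilbert space is a (global) symmetry of the system with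
quadratic form `a` on the form domain `V` if every `T ∈ O` maps `V` into `V` and leaves `a`
invariant. -/
def IsGlobalSymmetry {K : Type*} [NormedAddCommGroup K] [InnerProductSpace ℂ K] [CompleteSpace K]
    (V : Set K) (a : K → ℝ) (O : Subgroup (unitary (K →L[ℂ] K))) : Prop :=
  ∀ T ∈ O, ∀ f ∈ V, (T : K →L[ℂ] K) f ∈ V ∧ a ((T : K →L[ℂ] K) f) = a f

variable {N : ℕ} {H : Type*} [NormedAddCommGroup H] [InnerProductSpace ℂ H]

/-- `g = (g₁, …, g_N)` with `g_i ∈ L²(ℝ^N; H)` is the weak gradient of `f ∈ L²(ℝ^N; H)`: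
`∫ (∂_i φ) f = - ∫ φ g_i` for all test functions `φ` and all `i`. -/
def IsWeakGradient (f : L2 N H) (g : Fin N → L2 N H) : Prop :=
  ∀ φ : Space N → ℝ, ContDiff ℝ ∞ φ → HasCompactSupport φ → ∀ i : Fin N,
    ∫ x, (fderiv ℝ φ x (EuclideanSpace.single i 1)) • f x = - ∫ x, φ x • g i x

/-- The weak gradient in `L²` is unique. -/
theorem IsWeakGradient.unique [CompleteSpace H] {f : L2 N H} {g g' : Fin N → L2 N H}
    (h : IsWeakGradient f g) (h' : IsWeakGradient f g') : g = g' := by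
  funext i
  have hl : ∀ u : L2 N H, LocallyIntegrable u volume := fun u =>
    (Lp.memLp u).locallyIntegrable (by norm_num)
  have key : ∀ᵐ x ∂(volume : Measure (Space N)), g i x - g' i x = 0 := by
    refine ae_eq_zero_of_integral_contDiff_smul_eq_zero ((hl (g i)).sub (hl (g' i))) ?_
    intro φ hφ hc
    have hint : ∀ u : L2 N H, Integrable (fun x => φ x • u x) volume := fun u =>
      (hl u).integrable_smul_left_of_hasCompactSupport hφ.continuous hc
    have e := (h φ hφ hc i).symm.trans (h' φ hφ hc i)
    simp only [smul_sub]
    rw [integral_sub (hint _) (hint _), neg_injective e, sub_self]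
  apply Lp.ext
  filter_upwards [key] with x hx
  exact sub_eq_zero.mp hx

variable (N H) in
/-- The Sobolev space `H¹(ℝ^N; H)`, as a subset of `L²(ℝ^N; H)`. -/
def H1 : Set (L2 N H) := {f | ∃ g : Fin N → L2 N H, IsWeakGradient f g}

open Classical in
/-- The weak gradient `∇f` of `f ∈ H¹(ℝ^N; H)` (and `0` by convention if `f ∉ H¹`). -/
def weakGrad (f : L2 N H) : Fin N → L2 N H :=
  if h : ∃ g : Fin N → L2 N H, IsWeakGradient f g then h.choose else 0

theorem IsWeakGradient.weakGrad_eq [CompleteSpace H] {f : L2 N H} {g : Fin N → L2 N H}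
    (h : IsWeakGradient f g) : weakGrad f = g := by
  have hex : ∃ g : Fin N → L2 N H, IsWeakGradient f g := ⟨g, h⟩
  rw [weakGrad, dif_pos hex]
  exact hex.choose_spec.unique h

/-- The quadratic form of the Laplacian, `a(f) = ∫ ‖∇f(x)‖²_{H^N} dx`, on `H¹(ℝ^N; H)`. -/
def laplaceForm (f : L2 N H) : ℝ := ∫ x, ∑ i, ‖weakGrad f i x‖ ^ 2

/-- The closed subspace `{f ∈ L²(ℝ^N; H) : f(x) ∈ G_x for a.e. x}` of `L²(ℝ^N; H)` determined by
a family of closed subspaces `G_x` of `H`. -/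
def localSubspace (G : Space N → ClosedSubmodule ℂ H) : ClosedSubmodule ℂ (L2 N H) where
  carrier := {f | ∀ᵐ x, f x ∈ G x}
  zero_mem' := by
    filter_upwards [Lp.coeFn_zero H 2 (volume : Measure (Space N))] with x hx
    rw [hx]
    exact zero_mem (G x)
  add_mem' := by
    intro f g hf hg
    filter_upwards [hf, hg, Lp.coeFn_add f g] with x h1 h2 h3
    rw [h3]
    exact add_mem h1 h2
  smul_mem' := by
    intro c f hf
    filter_upwards [hf, Lp.coeFn_smul c f] with x h1 h2
    rw [h2]
    exact (G x).smul_mem c h1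
  isClosed' := by
    refine IsSeqClosed.isClosed ?_
    intro u f hu hf
    obtain ⟨ns, -, hns⟩ := (tendstoInMeasure_of_tendsto_Lp hf).exists_seq_tendsto_ae
    have hall : ∀ᵐ x : Space N, ∀ n, u n x ∈ G x := ae_all_iff.2 hu
    change ∀ᵐ x : Space N, f x ∈ G x
    filter_upwards [hns, hall] with x h1 h2
    exact (G x).isClosed.mem_of_tendsto h1 (Eventually.of_forall fun n => h2 (ns n))

/-- The projection-valued map `P` on `ℝ^N` is locally constant, with fibres in the class `𝒦` of
closed subspaces of `H`: there are pairwise disjoint open sets `U₀`, `U₁` and `U_e` (`e ∈ E`) whose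
union has a complement of measure zero, such that `P = 0` on `U₀`, `P = Id` on `U₁`, and on each
`U_e` the map `P` is the orthogonal projection onto one further closed subspace
`K_e ∈ 𝒦`, `K_e ≠ 0, H`. As `P` stands for a class of maps modulo null sets, its
restrictions are identified up to null sets. -/
def IsLocallyConstant [CompleteSpace H] (𝒦 : Set (ClosedSubmodule ℂ H))
    (P : Space N → H →L[ℂ] H) : Prop :=
  ∃ (E : Type) (U₀ U₁ : Set (Space N)) (U : E → Set (Space N)) (K : E → ClosedSubmodule ℂ H),
    (IsOpen U₀ ∧ IsOpen U₁ ∧ ∀ e, IsOpen (U e)) ∧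
    (Disjoint U₀ U₁ ∧ (∀ e, Disjoint U₀ (U e)) ∧ (∀ e, Disjoint U₁ (U e)) ∧
      Pairwise fun e e' => Disjoint (U e) (U e')) ∧
    volume (U₀ ∪ U₁ ∪ ⋃ e, U e)ᶜ = 0 ∧
    (∀ᵐ x, x ∈ U₀ → P x = 0) ∧
    (∀ᵐ x, x ∈ U₁ → P x = ContinuousLinearMap.id ℂ H) ∧
    ∀ e, K e ∈ 𝒦 ∧ K e ≠ ⊥ ∧ K e ≠ ⊤ ∧ ∀ᵐ x, x ∈ U e → P x = proj (K e)

end LocalSymmetry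

end

/-! The symmetry at `s = π` already forces `x ↦ P_x` to be constant almost everywhere on all of
`ℝ^N`. There the unitary is the reflection `R = 1 - 2P`. Since `R² = 1`, comparing `a(f + Rg)` with
`a(Rf + g)` gives `Re a(f, Rg) = Re a(Rf, g)`. For `f = φv` and `g = ψw`, integration by parts turns
this into `∫ (φ Δψ - ψ Δφ) u = 0` with `u(x) = (1 - 2P_x)v`
(`integral_lap_smul_reflection_eq_zero`).

A cutoff allows any smooth harmonic function in place of `φ`. Using `1` and `x_i`, together with
`Δ(x_i ψ) - x_i Δψ = 2 ∂_i ψ`, gives `∫ (∂_i ψ) u = 0` (`integral_pderiv_smul_eq_zero`). So `u` has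
zero weak gradient and is constant by mollification, and separability makes the exceptional null set
independent of `v`. The partition then has a single nonempty cell, the whole space. -/

noncomputable section

/-! ### Calculus of test functions. -/

namespace LocalSymmetry

open scoped Convolution

variable {N : ℕ}

/-- The `i`-th partial derivative of a real-valued function on `ℝ^N`. -/
def pderiv (i : Fin N) (φ : Space N → ℝ) (x : Space N) : ℝ :=
  fderiv ℝ φ x (EuclideanSpace.single i 1)

/-- The Laplacian of a real-valued function on `ℝ^N`. -/
def lap (φ : Space N → ℝ) (x : Space N) : ℝ := ∑ i, pderiv i (pderiv i φ) x

/-- Test functions: smooth real-valued functions with compact support. -/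
structure IsTest (φ : Space N → ℝ) : Prop where
  contDiff : ContDiff ℝ ∞ φ
  hasCompactSupport : HasCompactSupport φ

theorem contDiff_pderiv (i : Fin N) {φ : Space N → ℝ} (h : ContDiff ℝ ∞ φ) :
    ContDiff ℝ ∞ (pderiv i φ) :=
  (h.fderiv_right (m := ∞) (by simp)).clm_apply contDiff_const

theorem contDiff_lap {φ : Space N → ℝ} (h : ContDiff ℝ ∞ φ) : ContDiff ℝ ∞ (lap φ) :=
  ContDiff.sum fun i _ => contDiff_pderiv i (contDiff_pderiv i h)

theorem tsupport_pderiv_subset (i : Fin N) (φ : Space N → ℝ) :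
    tsupport (pderiv i φ) ⊆ tsupport φ :=
  tsupport_fderiv_apply_subset ℝ _

theorem IsTest.pderiv {φ : Space N → ℝ} (h : IsTest φ) (i : Fin N) : IsTest (pderiv i φ) :=
  ⟨contDiff_pderiv i h.contDiff, h.hasCompactSupport.fderiv_apply ℝ _⟩

theorem lap_eq_zero_of_notMem_tsupport {φ : Space N → ℝ} {x : Space N} (hx : x ∉ tsupport φ) :
    lap φ x = 0 :=
  Finset.sum_eq_zero fun i _ => image_eq_zero_of_notMem_tsupport fun h =>
    hx (tsupport_pderiv_subset i _ (tsupport_pderiv_subset i _ h))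

theorem IsTest.lap {φ : Space N → ℝ} (h : IsTest φ) : IsTest (lap φ) :=
  ⟨contDiff_lap h.contDiff, h.hasCompactSupport.mono' fun _ hx => by
    by_contra hn
    exact hx (lap_eq_zero_of_notMem_tsupport hn)⟩

theorem IsTest.mul_left {φ ψ : Space N → ℝ} (hφ : ContDiff ℝ ∞ φ) (hψ : IsTest ψ) :
    IsTest (fun x => φ x * ψ x) :=
  ⟨hφ.mul hψ.contDiff, hψ.hasCompactSupport.mul_left⟩

theorem pderiv_congr (i : Fin N) {φ ψ : Space N → ℝ} {x : Space N} (h : φ =ᶠ[𝓝 x] ψ) :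
    pderiv i φ =ᶠ[𝓝 x] pderiv i ψ := by
  filter_upwards [h.fderiv (𝕜 := ℝ)] with y hy
  simp only [pderiv, hy]

theorem lap_congr {φ ψ : Space N → ℝ} {x : Space N} (h : φ =ᶠ[𝓝 x] ψ) : lap φ x = lap ψ x :=
  Finset.sum_congr rfl fun i _ => (pderiv_congr i (pderiv_congr i h)).eq_of_nhds

theorem pderiv_mul (i : Fin N) {φ ψ : Space N → ℝ} (hφ : ContDiff ℝ ∞ φ) (hψ : ContDiff ℝ ∞ ψ) :
    pderiv i (fun x => φ x * ψ x) = fun x => φ x * pderiv i ψ x + pderiv i φ x * ψ x := by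
  funext x
  have := fderiv_fun_mul (𝕜 := ℝ) (hφ.differentiable (by simp) x) (hψ.differentiable (by simp) x)
  simp only [pderiv, this]
  simp [mul_comm]

theorem pderiv_add (i : Fin N) {φ ψ : Space N → ℝ} (hφ : ContDiff ℝ ∞ φ) (hψ : ContDiff ℝ ∞ ψ)
    (x : Space N) : pderiv i (fun x => φ x + ψ x) x = pderiv i φ x + pderiv i ψ x := by
  have := fderiv_fun_add (𝕜 := ℝ) (hφ.differentiable (by simp) x) (hψ.differentiable (by simp) x)
  simp only [pderiv, this]
  simp

theorem lap_mul {φ ψ : Space N → ℝ} (hφ : ContDiff ℝ ∞ φ) (hψ : ContDiff ℝ ∞ ψ) (x : Space N) :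
    lap (fun x => φ x * ψ x) x =
      φ x * lap ψ x + 2 * ∑ i, pderiv i φ x * pderiv i ψ x + lap φ x * ψ x := by
  have key : ∀ i, pderiv i (pderiv i (fun x => φ x * ψ x)) x =
      φ x * pderiv i (pderiv i ψ) x + 2 * (pderiv i φ x * pderiv i ψ x)
        + pderiv i (pderiv i φ) x * ψ x := fun i => by
    have h1 := contDiff_pderiv i hφ
    have h2 := contDiff_pderiv i hψ
    rw [pderiv_mul i hφ hψ, pderiv_add i (hφ.mul h2) (h1.mul hψ), pderiv_mul i hφ h2,
      pderiv_mul i h1 hψ]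
    ring
  simp only [lap, key, Finset.sum_add_distrib, Finset.mul_sum, Finset.sum_mul]

theorem contDiff_coord (i : Fin N) : ContDiff ℝ ∞ (fun x : Space N => x i) :=
  (EuclideanSpace.proj (𝕜 := ℝ) i).contDiff

theorem pderiv_coord (i j : Fin N) :
    pderiv j (fun x : Space N => x i) = fun _ => if i = j then 1 else 0 := by
  funext x
  have : fderiv ℝ (fun x : Space N => x i) x = EuclideanSpace.proj (𝕜 := ℝ) i :=
    (EuclideanSpace.proj (𝕜 := ℝ) i).fderiv
  rw [pderiv, this]
  simp

theorem pderiv_const (i : Fin N) (c : ℝ) : pderiv i (fun _ : Space N => c) = fun _ => 0 := by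
  funext x
  simp [pderiv]

/-! ### Constancy from the symmetric Laplacian identity. -/

variable {E : Type*} [NormedAddCommGroup E] [NormedSpace ℝ E]

theorem IsTest.integrable_smul {φ : Space N → ℝ} (h : IsTest φ) {u : Space N → E}
    (hu : LocallyIntegrable u volume) : Integrable (fun x => φ x • u x) volume :=
  hu.integrable_smul_left_of_hasCompactSupport h.contDiff.continuous h.hasCompactSupport

/-- If `∫ (φ Δψ - ψ Δφ) u = 0` for all test functions `φ, ψ`, then `∫ (L Δψ) u = 0` for all
smooth harmonic `L`. -/
theorem integral_harmonic_mul_lap_smul_eq_zero {u : Space N → E}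
    (h : ∀ φ ψ : Space N → ℝ, IsTest φ → IsTest ψ →
      ∫ x, (φ x * lap ψ x - ψ x * lap φ x) • u x = 0)
    {L ψ : Space N → ℝ} (hL : ContDiff ℝ ∞ L) (hL0 : ∀ x, lap L x = 0) (hψ : IsTest ψ) :
    ∫ x, (L x * lap ψ x) • u x = 0 := by
  obtain ⟨r, hr⟩ := hψ.hasCompactSupport.isCompact.isBounded.subset_ball (0 : Space N)
  -- A cutoff equal to `1` near `tsupport ψ`, so that `L * χ` is an admissible `φ`. The maximum with
  -- `1` keeps the inner radius positive.
  let χ : ContDiffBump (0 : Space N) :=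
    ⟨max r 1, max r 1 + 1, by positivity, by linarith⟩
  have hχ : ∀ x ∈ tsupport ψ, (fun y => L y * χ y) =ᶠ[𝓝 x] L := fun x hx => by
    have hx' : x ∈ Metric.ball (0 : Space N) χ.rIn :=
      Metric.ball_subset_ball (le_max_left _ _) (hr hx)
    filter_upwards [χ.eventuallyEq_one_of_mem_ball hx'] with y hy
    rw [hy]
    simp
  rw [← h _ ψ (IsTest.mul_left hL ⟨χ.contDiff, χ.hasCompactSupport⟩) hψ]
  congr 1
  funext x
  by_cases hx : x ∈ tsupport ψ
  · rw [lap_congr (hχ x hx), (hχ x hx).eq_of_nhds, hL0]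
    simp
  · rw [lap_eq_zero_of_notMem_tsupport hx, image_eq_zero_of_notMem_tsupport hx]
    simp

/-- If `∫ (φ Δψ - ψ Δφ) u = 0` for all test functions `φ, ψ`, then `∇u = 0` weakly. -/
theorem integral_pderiv_smul_eq_zero {u : Space N → E} (hu : LocallyIntegrable u volume)
    (h : ∀ φ ψ : Space N → ℝ, IsTest φ → IsTest ψ →
      ∫ x, (φ x * lap ψ x - ψ x * lap φ x) • u x = 0)
    {ψ : Space N → ℝ} (hψ : IsTest ψ) (i : Fin N) : ∫ x, pderiv i ψ x • u x = 0 := by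
  have hc : ∀ x : Space N, lap (fun x => x i) x = 0 := fun x => by
    simp [lap, pderiv_coord, pderiv_const]
  -- The pairs `(x_i, ψ)` and `(1, x_i ψ)` have integrands differing by exactly `2 ∂_i ψ • u`.
  have h1 := integral_harmonic_mul_lap_smul_eq_zero h (contDiff_coord i) hc hψ
  have h2 := integral_harmonic_mul_lap_smul_eq_zero h (L := fun _ => 1) contDiff_const
    (fun x => by simp [lap, pderiv_const]) (IsTest.mul_left (contDiff_coord i) hψ)
  have e : ∀ x : Space N, (1 * lap (fun x => x i * ψ x) x) • u x =
      (x i * lap ψ x) • u x + (2 : ℝ) • (pderiv i ψ x • u x) := fun x => by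
    rw [lap_mul (contDiff_coord i) hψ.contDiff, hc]
    simp only [pderiv_coord]
    simp [add_smul, mul_smul]
  simp only [e] at h2
  have hi : Integrable (fun x => (2 : ℝ) • (pderiv i ψ x • u x)) volume :=
    ((hψ.pderiv i).integrable_smul hu).smul 2
  rw [integral_add ((IsTest.mul_left (contDiff_coord i) hψ.lap).integrable_smul hu) hi, h1, integral_smul, zero_add] at h2
  simpa using h2

/-- The convolution of a test function with a function with vanishing weak gradient is constant. -/
theorem convolution_eq_of_integral_pderiv_eq_zero {u : Space N → E}
    (hu : LocallyIntegrable u volume)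
    (h : ∀ ψ : Space N → ℝ, IsTest ψ → ∀ i, ∫ x, pderiv i ψ x • u x = 0)
    {ρ : Space N → ℝ} (hρ : IsTest ρ) (x y : Space N) :
    (ρ ⋆[ContinuousLinearMap.lsmul ℝ ℝ, volume] u) x =
      (ρ ⋆[ContinuousLinearMap.lsmul ℝ ℝ, volume] u) y := by
  have hd := hρ.hasCompactSupport.hasFDerivAt_convolution_left (μ := volume)
    (ContinuousLinearMap.lsmul ℝ ℝ) (hρ.contDiff.of_le (by simp)) hu
  refine is_const_of_fderiv_eq_zero (𝕜 := ℝ) (fun x => (hd x).differentiableAt) (fun x => ?_) x y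
  rw [(hd x).fderiv]
  have hint := (hρ.hasCompactSupport.fderiv ℝ).convolutionExists_left (μ := volume)
    ((ContinuousLinearMap.lsmul ℝ ℝ (E := E)).precompL (Space N))
    (hρ.contDiff.continuous_fderiv (by simp)) hu x
  have hb : ∀ i, ((fderiv ℝ ρ) ⋆[(ContinuousLinearMap.lsmul ℝ ℝ (E := E)).precompL (Space N),
      volume] u) x (EuclideanSpace.single i 1) = 0 := fun i => by
    rw [convolution_eq_swap, ContinuousLinearMap.integral_apply hint.integrable_swap]
    -- The reflected translate of `ρ` serves as test function; the chain rule accounts for the sign.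
    have hψ : IsTest fun t => ρ (x - t) :=
      ⟨hρ.contDiff.comp (contDiff_const.sub contDiff_id),
        hρ.hasCompactSupport.comp_homeomorph (Homeomorph.subLeft x)⟩
    rw [← neg_eq_zero, ← integral_neg, ← h _ hψ i]
    congr 1
    funext t
    have : fderiv ℝ (fun t => ρ (x - t)) t = - fderiv ℝ ρ (x - t) := by
      have h1 := ((hρ.contDiff.differentiable (by simp) (x - t)).hasFDerivAt).comp t
        ((hasFDerivAt_id (𝕜 := ℝ) t).const_sub x)
      have h2 := h1.fderiv
      simpa [Function.comp_def] using h2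
    simp [pderiv, this, ContinuousLinearMap.precompL_apply]
  ext z
  rw [← (EuclideanSpace.basisFun (Fin N) ℝ).sum_repr z]
  simp [hb]

/-- A locally integrable function with vanishing weak gradient is constant a.e. -/
theorem ae_eq_const_of_integral_pderiv_eq_zero [CompleteSpace E] {u : Space N → E}
    (hu : LocallyIntegrable u volume)
    (h : ∀ ψ : Space N → ℝ, IsTest ψ → ∀ i, ∫ x, pderiv i ψ x • u x = 0) :
    ∃ c, ∀ᵐ x, u x = c := by
  -- Outer radius twice the inner one: the bounded ratio gives a.e. convergence of the
  -- mollifications for merely locally integrable `u`.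
  let ρ : ℕ → ContDiffBump (0 : Space N) := fun n =>
    ⟨1 / (n + 1 : ℝ), 2 * (1 / (n + 1 : ℝ)), by positivity, by
      have : (0 : ℝ) < 1 / (n + 1 : ℝ) := by positivity
      linarith⟩
  have hlim : Tendsto (fun n => (ρ n).rOut) atTop (𝓝 0) := by
    have := (tendsto_one_div_add_atTop_nhds_zero_nat (𝕜 := ℝ)).const_mul 2
    rwa [mul_zero] at this
  have hae := ContDiffBump.ae_convolution_tendsto_right_of_locallyIntegrable (K := 2) hlim
    (Eventually.of_forall fun n => le_rfl) hu
  obtain ⟨x₀, hx₀⟩ := hae.exists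
  refine ⟨u x₀, hae.mono fun x hx => tendsto_nhds_unique hx (hx₀.congr fun n => ?_)⟩
  exact convolution_eq_of_integral_pderiv_eq_zero hu h
    ⟨(ρ n).contDiff_normed, (ρ n).hasCompactSupport_normed⟩ x₀ x

end LocalSymmetry

/-! ### The reflection in the unitary group. -/

namespace LocalSymmetry

open scoped InnerProductSpace

/-- For an idempotent `p`, `e^{cp} = 1 + (e^c - 1) p`. -/
theorem exp_smul_of_isIdempotentElem {A : Type*} [NormedRing A] [NormedAlgebra ℂ A]
    [CompleteSpace A] {p : A} (hp : IsIdempotentElem p) (c : ℂ) :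
    NormedSpace.exp (c • p) = 1 + (Complex.exp c - 1) • p := by
  have h1 := NormedSpace.exp_series_hasSum_exp' (𝕂 := ℂ) (c • p)
  have h2 := (NormedSpace.exp_series_hasSum_exp' (𝕂 := ℂ) c).smul_const p
  rw [← Complex.exp_eq_exp_ℂ] at h2
  -- The two series differ only at `n = 0`, where `p` must become `1`.
  have h3 := (hasSum_ite_eq (0 : ℕ) (1 - p)).add h2
  have h4 : 1 + (Complex.exp c - 1) • p = 1 - p + Complex.exp c • p := by
    rw [sub_smul, one_smul]
    abel
  rw [h4]
  refine h1.unique (h3.congr_fun fun n => ?_)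
  cases n with
  | zero => simp
  | succ n => simp [smul_pow, hp.pow_succ_eq, smul_smul]

section Reflection

variable {K : Type*} [NormedAddCommGroup K] [InnerProductSpace ℂ K] [CompleteSpace K]

theorem proj_proj (G : ClosedSubmodule ℂ K) (x : K) : proj G (proj G x) = proj G x :=
  congrArg (fun T : K →L[ℂ] K => T x) G.toSubmodule.isIdempotentElem_starProjection

/-- The unitary `e^{iπP}` is the reflection `1 - 2P`. -/
theorem expGroup_pi_apply (G : ClosedSubmodule ℂ K) (x : K) :
    (expGroup G (Multiplicative.ofAdd Real.pi) : K →L[ℂ] K) x = x - 2 • proj G x := by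
  change NormedSpace.exp ((Complex.I * (Real.pi : ℂ)) • proj G) x = _
  have hp : IsIdempotentElem (proj G) := G.toSubmodule.isIdempotentElem_starProjection
  rw [exp_smul_of_isIdempotentElem hp, mul_comm, Complex.exp_pi_mul_I]
  norm_num [two_smul, sub_eq_add_neg]

end Reflection

/-! ### Weak gradients and the Laplace form. -/

variable {N : ℕ} {H : Type*} [NormedAddCommGroup H] [InnerProductSpace ℂ H]

theorem IsTest.memLp_smul {φ : Space N → ℝ} (h : IsTest φ) (v : H) :
    MemLp (fun x => φ x • v) 2 (volume : Measure (Space N)) :=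
  (h.contDiff.continuous.smul continuous_const).memLp_of_hasCompactSupport
    h.hasCompactSupport.smul_right

/-- The element `φ v` of `L²(ℝ^N; H)` for a test function `φ` and `v ∈ H`. -/
def IsTest.toL2 {φ : Space N → ℝ} (h : IsTest φ) (v : H) : L2 N H := (h.memLp_smul v).toLp

theorem IsTest.coeFn_toL2 {φ : Space N → ℝ} (h : IsTest φ) (v : H) :
    ∀ᵐ x, h.toL2 v x = φ x • v :=
  MemLp.coeFn_toLp _

theorem locallyIntegrable_L2 {H : Type*} [NormedAddCommGroup H] (f : L2 N H) : LocallyIntegrable f volume :=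
  (Lp.memLp f).locallyIntegrable (by norm_num)

theorem IsTest.isWeakGradient_toL2 {φ : Space N → ℝ} (h : IsTest φ) (v : H) :
    IsWeakGradient (h.toL2 v) fun i => (h.pderiv i).toL2 v := by
  intro ψ hψ hc i
  have hT : IsTest ψ := ⟨hψ, hc⟩
  have e1 : ∫ x, fderiv ℝ ψ x (EuclideanSpace.single i 1) • h.toL2 v x =
      ∫ x, (LocalSymmetry.pderiv i ψ x * φ x) • v :=
    integral_congr_ae <| (h.coeFn_toL2 v).mono fun x hx => by
      simp only [hx, mul_smul, LocalSymmetry.pderiv]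
  have e2 : ∫ x, ψ x • (h.pderiv i).toL2 v x = ∫ x, (ψ x * LocalSymmetry.pderiv i φ x) • v :=
    integral_congr_ae <| ((h.pderiv i).coeFn_toL2 v).mono fun x hx => by
      simp only [hx, mul_smul]
  have hint : ∀ {a b : Space N → ℝ}, IsTest a → IsTest b →
      Integrable (fun x => a x * b x) volume := fun ha hb =>
    (IsTest.mul_left ha.contDiff hb).contDiff.continuous.integrable_of_hasCompactSupport
      (IsTest.mul_left ha.contDiff hb).hasCompactSupport
  have key := integral_mul_fderiv_eq_neg_fderiv_mul_of_integrable (μ := volume) (f := ψ) (g := φ)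
    (v := EuclideanSpace.single i 1) (hint (hT.pderiv i) h) (hint hT (h.pderiv i)) (hint hT h)
    (fun x _ => hψ.differentiable (by simp) x) (fun x _ => h.contDiff.differentiable (by simp) x)
  by_cases hH : CompleteSpace H
  · rw [e1, e2, integral_smul_const, integral_smul_const]
    simp only [LocalSymmetry.pderiv]
    rw [key, neg_smul, neg_neg]
  -- Without completeness the Bochner integral is `0` by convention.
  · simp [integral, hH]

theorem IsWeakGradient.add {f f' : L2 N H} {g g' : Fin N → L2 N H} (h : IsWeakGradient f g)
    (h' : IsWeakGradient f' g') : IsWeakGradient (f + f') (g + g') := by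
  intro φ hφ hc i
  have hT : IsTest φ := ⟨hφ, hc⟩
  have e1 : ∫ x, fderiv ℝ φ x (EuclideanSpace.single i 1) • (f + f') x =
      ∫ x, (pderiv i φ x • f x + pderiv i φ x • f' x) :=
    integral_congr_ae <| (Lp.coeFn_add f f').mono fun x hx => by
      simp only [hx, Pi.add_apply, smul_add, pderiv]
  have e2 : ∫ x, φ x • (g + g') i x = ∫ x, (φ x • g i x + φ x • g' i x) :=
    integral_congr_ae <| (Lp.coeFn_add (g i) (g' i)).mono fun x hx => by
      simp only [Pi.add_apply, hx, smul_add]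
  rw [e1, e2, integral_add ((hT.pderiv i).integrable_smul (locallyIntegrable_L2 f))
    ((hT.pderiv i).integrable_smul (locallyIntegrable_L2 f')),
    integral_add (hT.integrable_smul (locallyIntegrable_L2 (g i)))
    (hT.integrable_smul (locallyIntegrable_L2 (g' i))), neg_add]
  exact congrArg₂ (· + ·) (h φ hφ hc i) (h' φ hφ hc i)

theorem IsWeakGradient.laplaceForm_eq [CompleteSpace H] {f : L2 N H} {g : Fin N → L2 N H}
    (h : IsWeakGradient f g) : laplaceForm f = ∑ i, ‖g i‖ ^ 2 := by
  have hsq : ∀ u : L2 N H, Integrable (fun x => ‖u x‖ ^ 2) volume := fun u =>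
    (Lp.memLp u).integrable_norm_pow (by norm_num)
  rw [laplaceForm, h.weakGrad_eq, integral_finsetSum _ fun i _ => hsq (g i)]
  refine Finset.sum_congr rfl fun i _ => ?_
  have e : (⟪g i, g i⟫_ℂ : ℂ) = ((∫ x, ‖g i x‖ ^ 2 : ℝ) : ℂ) := by
    rw [L2.inner_def, ← integral_complex_ofReal]
    simp [inner_self_eq_norm_sq_to_K]
  rw [← Complex.ofReal_inj, ← e, inner_self_eq_norm_sq_to_K]
  simp

theorem inner_real_smul_right (r : ℝ) (v w : H) : ⟪v, r • w⟫_ℂ = r * ⟪v, w⟫_ℂ := by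
  rw [← Complex.coe_smul, inner_smul_right]

theorem inner_real_smul_left (r : ℝ) (v w : H) : ⟪r • v, w⟫_ℂ = r * ⟪v, w⟫_ℂ := by
  rw [← Complex.coe_smul, inner_smul_left, Complex.conj_ofReal]

variable [CompleteSpace H]

theorem IsTest.inner_toL2 {φ : Space N → ℝ} (h : IsTest φ) (v : H) (f : L2 N H) :
    ⟪h.toL2 v, f⟫_ℂ = ⟪v, ∫ x, φ x • f x⟫_ℂ := by
  rw [L2.inner_def, ← integral_inner (h.integrable_smul (locallyIntegrable_L2 f))]
  refine integral_congr_ae ((h.coeFn_toL2 v).mono fun x hx => ?_)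
  simp only [hx, inner_real_smul_left, inner_real_smul_right]

/-- The weak gradient of `f` is tested against `∂_i φ`, putting both derivatives on `φ`; nothing
beyond `f ∈ H¹` is needed. -/
theorem sum_inner_pderiv_toL2 {φ : Space N → ℝ} (h : IsTest φ) (v : H) {f : L2 N H}
    {F : Fin N → L2 N H} (hf : IsWeakGradient f F) :
    ∑ i, ⟪(h.pderiv i).toL2 v, F i⟫_ℂ = -⟪v, ∫ x, lap φ x • f x⟫_ℂ := by
  have e : ∫ x, lap φ x • f x = ∑ i, ∫ x, pderiv i (pderiv i φ) x • f x := by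
    rw [← integral_finsetSum _ fun i _ =>
      ((h.pderiv i).pderiv i).integrable_smul (locallyIntegrable_L2 f)]
    simp only [lap, Finset.sum_smul]
  rw [e, inner_sum, ← Finset.sum_neg_distrib]
  refine Finset.sum_congr rfl fun i _ => ?_
  have := hf _ (h.pderiv i).contDiff (h.pderiv i).hasCompactSupport i
  rw [IsTest.inner_toL2, ← inner_neg_right]
  congr 1
  rw [← neg_eq_iff_eq_neg.2 this]
  rfl

/-! ### The fibrewise reflection and its rigidity. -/

theorem norm_proj_le (G : ClosedSubmodule ℂ H) (v : H) : ‖proj G v‖ ≤ ‖v‖ :=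
  G.toSubmodule.norm_starProjection_apply_le v

/-- The projection onto `{f : f(x) ∈ G_x a.e.}` acts fibrewise by the projections onto `G_x`. -/
theorem proj_localSubspace_toL2 {G : Space N → ClosedSubmodule ℂ H}
    (hmeas : ∀ v : H, AEStronglyMeasurable (fun x => proj (G x) v) volume)
    {φ : Space N → ℝ} (h : IsTest φ) (v : H) :
    ∀ᵐ x, proj (localSubspace G) (h.toL2 v) x = φ x • proj (G x) v := by
  have hm : MemLp (fun x => φ x • proj (G x) v) 2 volume := by
    refine (h.memLp_smul v).mono
      (h.contDiff.continuous.aestronglyMeasurable.smul (hmeas v)) (ae_of_all _ fun x => ?_)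
    rw [norm_smul, norm_smul]
    exact mul_le_mul_of_nonneg_left (norm_proj_le _ _) (norm_nonneg _)
  have hmem : ∀ r : ℝ, ∀ x, r • proj (G x) v ∈ G x := fun r x => by
    rw [← Complex.coe_smul]
    exact (G x).smul_mem _ ((G x).toSubmodule.starProjection_apply_mem v)
  have key : proj (localSubspace G) (h.toL2 v) = hm.toLp := by
    refine (localSubspace G).toSubmodule.eq_starProjection_of_mem_of_inner_eq_zero ?_ ?_
    · change ∀ᵐ x, hm.toLp _ x ∈ G x
      filter_upwards [hm.coeFn_toLp] with x hx
      rw [hx]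
      exact hmem _ x
    · intro g hg
      have hg' : ∀ᵐ x, g x ∈ G x := hg
      rw [L2.inner_def]
      refine integral_eq_zero_of_ae ?_
      filter_upwards [hm.coeFn_toLp, h.coeFn_toL2 v, Lp.coeFn_sub (h.toL2 v) hm.toLp, hg']
        with x h1 h2 h3 h4
      rw [h3, Pi.sub_apply, h1, h2, ← smul_sub, inner_real_smul_left]
      have := (G x).toSubmodule.starProjection_inner_eq_zero v (g x) h4
      rw [proj, this, mul_zero]
      rfl
  rw [key]
  exact hm.coeFn_toLp

theorem locallyIntegrable_sub_two_smul_proj {G : Space N → ClosedSubmodule ℂ H}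
    (hmeas : ∀ v : H, AEStronglyMeasurable (fun x => proj (G x) v) volume) (w : H) :
    LocallyIntegrable (fun x => w - 2 • proj (G x) w) volume :=
  (locallyIntegrable_const (3 * ‖w‖)).mono
    (aestronglyMeasurable_const.sub ((hmeas w).const_smul 2)) (ae_of_all _ fun x => by
      rw [Real.norm_of_nonneg (by positivity), two_smul]
      have h1 := norm_sub_le w (proj (G x) w + proj (G x) w)
      have h2 := norm_add_le (proj (G x) w) (proj (G x) w)
      have h3 := norm_proj_le (G x) w
      linarith)

/-- The pointwise reflections `1 - 2P_x` satisfy `∫ (φ Δψ - ψ Δφ) (1 - 2P_x) v = 0`. -/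
theorem integral_lap_smul_reflection_eq_zero {G : Space N → ClosedSubmodule ℂ H}
    (hmeas : ∀ v : H, AEStronglyMeasurable (fun x => proj (G x) v) volume)
    (hsymm : IsGlobalSymmetry (H1 N H) laplaceForm (expGroup (localSubspace G)).range)
    (v : H) {φ ψ : Space N → ℝ} (hφ : IsTest φ) (hψ : IsTest ψ) :
    ∫ x, (φ x * lap ψ x - ψ x * lap φ x) • (v - 2 • proj (G x) v) = 0 := by
  set Q := proj (localSubspace G) with hQ
  have hR : ∀ f ∈ H1 N H, f - 2 • Q f ∈ H1 N H ∧ laplaceForm (f - 2 • Q f) = laplaceForm f :=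
    fun f hf => by
      have := hsymm _ ⟨Multiplicative.ofAdd Real.pi, rfl⟩ f hf
      rwa [expGroup_pi_apply] at this
  have hloc := locallyIntegrable_sub_two_smul_proj hmeas
  -- Self-adjointness of each `1 - 2P_x`, in real parts because polarization of the real form `a`
  -- yields only those.
  have hsa : ∀ (v w : H) (χ : Space N → ℝ), IsTest χ →
      (⟪v, ∫ x, χ x • (w - 2 • proj (G x) w)⟫_ℂ).re =
        (⟪w, ∫ x, χ x • (v - 2 • proj (G x) v)⟫_ℂ).re := fun v w χ hχ => by
    rw [← integral_inner (hχ.integrable_smul (hloc w)),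
      ← integral_inner (hχ.integrable_smul (hloc v)), ← Complex.conj_re, ← integral_conj]
    congr 2
    funext x
    have : ⟪proj (G x) w, v⟫_ℂ = ⟪w, proj (G x) v⟫_ℂ :=
      (G x).toSubmodule.inner_starProjection_left_eq_right w v
    rw [inner_real_smul_right, inner_real_smul_right, map_mul, Complex.conj_ofReal, inner_conj_symm,
      two_smul, two_smul, inner_sub_left, inner_sub_right, inner_add_left, inner_add_right, this]
  have hint : ∀ (w : H) (χ η : Space N → ℝ) (hχ : IsTest χ),
      ∫ x, η x • (hχ.toL2 w - 2 • Q (hχ.toL2 w)) x =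
        ∫ x, (χ x * η x) • (w - 2 • proj (G x) w) := fun w χ η hχ => by
    refine integral_congr_ae ?_
    filter_upwards [hχ.coeFn_toL2 w, proj_localSubspace_toL2 hmeas hχ w,
      Lp.coeFn_sub (hχ.toL2 w) (2 • Q (hχ.toL2 w)),
      Lp.coeFn_add (Q (hχ.toL2 w)) (Q (hχ.toL2 w))] with x h1 h2 h3 h4
    rw [h3, two_smul, Pi.sub_apply, h4, Pi.add_apply, h1, hQ, h2, two_smul, mul_comm, mul_smul,
      smul_sub (χ x), smul_add (χ x)]
  have key : ∀ w : H, (⟪w, ∫ x, (φ x * lap ψ x) • (v - 2 • proj (G x) v)⟫_ℂ).re =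
      (⟪w, ∫ x, (ψ x * lap φ x) • (v - 2 • proj (G x) v)⟫_ℂ).re := fun w => by
    have hf := hφ.isWeakGradient_toL2 v
    have hg := hψ.isWeakGradient_toL2 w
    obtain ⟨⟨F, hF⟩, haf⟩ := hR _ ⟨_, hf⟩
    obtain ⟨⟨D, hD⟩, hag⟩ := hR _ ⟨_, hg⟩
    -- Invariance at `f + Rg`, which `R` sends to `Rf + g`. The square terms cancel by `haf` and
    -- `hag`, leaving the cross terms.
    obtain ⟨-, hafg⟩ := hR _ ⟨_, hf.add hD⟩
    have hQQ : ∀ f, Q (Q f) = Q f := proj_proj _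
    have e : hφ.toL2 v + (hψ.toL2 w - 2 • Q (hψ.toL2 w)) -
        2 • Q (hφ.toL2 v + (hψ.toL2 w - 2 • Q (hψ.toL2 w))) =
        (hφ.toL2 v - 2 • Q (hφ.toL2 v)) + hψ.toL2 w := by
      simp only [two_smul, map_add, map_sub, hQQ]
      abel
    rw [e, (hF.add hg).laplaceForm_eq, (hf.add hD).laplaceForm_eq] at hafg
    rw [hF.laplaceForm_eq, hf.laplaceForm_eq] at haf
    rw [hD.laplaceForm_eq, hg.laplaceForm_eq] at hag
    simp only [Pi.add_apply, norm_add_sq (𝕜 := ℂ), Finset.sum_add_distrib, ← Finset.mul_sum,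
      ← map_sum] at hafg
    have h1 := sum_inner_pderiv_toL2 hφ v hD
    have h2 := sum_inner_pderiv_toL2 hψ w hF
    rw [hint w ψ _ hψ] at h1
    rw [hint v φ _ hφ] at h2
    have h3 : (∑ i, ⟪F i, (hψ.pderiv i).toL2 w⟫_ℂ).re =
        (∑ i, ⟪(hψ.pderiv i).toL2 w, F i⟫_ℂ).re := by
      rw [Complex.re_sum, Complex.re_sum]
      exact Finset.sum_congr rfl fun i _ => inner_re_symm (𝕜 := ℂ) _ _
    simp only [RCLike.re_eq_complex_re, h1, h3, h2] at hafg
    rw [Complex.neg_re, Complex.neg_re, hsa v w _ (IsTest.mul_left hψ.contDiff hφ.lap)] at hafg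
    linarith
  set I := ∫ x, (φ x * lap ψ x - ψ x * lap φ x) • (v - 2 • proj (G x) v) with hI
  have hsub : I = (∫ x, (φ x * lap ψ x) • (v - 2 • proj (G x) v)) -
      ∫ x, (ψ x * lap φ x) • (v - 2 • proj (G x) v) := by
    rw [← integral_sub ((IsTest.mul_left hφ.contDiff hψ.lap).integrable_smul (hloc v))
      ((IsTest.mul_left hψ.contDiff hφ.lap).integrable_smul (hloc v))]
    simp only [hI, sub_smul]
  -- Taking `w = I` makes the real part of the pairing sufficient.
  have h0 : (⟪I, I⟫_ℂ).re = 0 := by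
    nth_rewrite 2 [hsub]
    rw [inner_sub_right, Complex.sub_re, key I, sub_self]
  exact norm_eq_zero.1 (pow_eq_zero_iff two_ne_zero |>.1
    ((inner_self_eq_norm_sq (𝕜 := ℂ) I).symm.trans h0))

/-- Under the symmetry hypothesis, each `x ↦ P_x v` is constant a.e. -/
theorem exists_ae_proj_apply_eq {G : Space N → ClosedSubmodule ℂ H}
    (hmeas : ∀ v : H, AEStronglyMeasurable (fun x => proj (G x) v) volume)
    (hsymm : IsGlobalSymmetry (H1 N H) laplaceForm (expGroup (localSubspace G)).range) (v : H) :
    ∃ c, ∀ᵐ x, proj (G x) v = c := by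
  have hu := locallyIntegrable_sub_two_smul_proj hmeas v
  obtain ⟨c, hc⟩ := ae_eq_const_of_integral_pderiv_eq_zero hu fun ψ hψ i =>
    integral_pderiv_smul_eq_zero hu
      (fun φ ψ hφ hψ => integral_lap_smul_reflection_eq_zero hmeas hsymm v hφ hψ) hψ i
  refine ⟨(2 : ℝ)⁻¹ • (v - c), hc.mono fun x hx => ?_⟩
  rw [← hx, sub_sub_cancel, ← Nat.cast_smul_eq_nsmul ℝ, smul_smul]
  norm_num

/-- Under the symmetry hypothesis, `x ↦ P_x` is constant a.e. -/
theorem ae_proj_eq [TopologicalSpace.SeparableSpace H] {G : Space N → ClosedSubmodule ℂ H}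
    (hmeas : ∀ v : H, AEStronglyMeasurable (fun x => proj (G x) v) volume)
    (hsymm : IsGlobalSymmetry (H1 N H) laplaceForm (expGroup (localSubspace G)).range) :
    ∀ᵐ x₀, ∀ᵐ x, proj (G x) = proj (G x₀) := by
  choose c hc using exists_ae_proj_apply_eq hmeas hsymm
  -- A countable dense set gives one null set for all vectors; continuity of the projections does
  -- the rest.
  have hall : ∀ᵐ x : Space N, ∀ n, proj (G x) (TopologicalSpace.denseSeq H n) =
      c (TopologicalSpace.denseSeq H n) := ae_all_iff.2 fun n => hc _
  filter_upwards [hall] with x₀ h₀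
  filter_upwards [hall] with x hx
  refine DFunLike.coe_injective ((TopologicalSpace.denseRange_denseSeq H).equalizer
    (proj (G x)).continuous (proj (G x₀)).continuous (funext fun n => ?_))
  exact (hx n).trans (h₀ n).symm

/-! ### From a constant projection to the partition. -/

theorem proj_bot : proj (⊥ : ClosedSubmodule ℂ H) = 0 := by
  ext v
  exact (Submodule.mem_bot ℂ).1
    ((⊥ : ClosedSubmodule ℂ H).toSubmodule.starProjection_apply_mem v)

theorem proj_top : proj (⊤ : ClosedSubmodule ℂ H) = ContinuousLinearMap.id ℂ H := by
  ext v
  exact Submodule.starProjection_eq_self_iff.2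
    (show v ∈ (⊤ : ClosedSubmodule ℂ H).toSubmodule from Submodule.mem_top)

theorem isLocallyConstant_of_ae_eq {𝒦 : Set (ClosedSubmodule ℂ H)} {P : Space N → H →L[ℂ] H}
    {K : ClosedSubmodule ℂ H} (hK : K ∈ 𝒦) (h : ∀ᵐ x, P x = proj K) :
    IsLocallyConstant 𝒦 P := by
  by_cases h0 : K = ⊥
  · exact ⟨Empty, Set.univ, ∅, fun _ => ∅, fun _ => K, ⟨isOpen_univ, isOpen_empty, nofun⟩,
      ⟨by simp, nofun, nofun, nofun⟩, by simp,
      h.mono fun x hx _ => by rw [hx, h0, proj_bot], by simp, nofun⟩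
  by_cases h1 : K = ⊤
  · exact ⟨Empty, ∅, Set.univ, fun _ => ∅, fun _ => K, ⟨isOpen_empty, isOpen_univ, nofun⟩,
      ⟨by simp, nofun, nofun, nofun⟩, by simp, by simp,
      h.mono fun x hx _ => by rw [hx, h1, proj_top], nofun⟩
  exact ⟨Unit, ∅, ∅, fun _ => Set.univ, fun _ => K,
    ⟨isOpen_empty, isOpen_empty, fun _ => isOpen_univ⟩,
    ⟨by simp, by simp, by simp, fun a b hab => (hab rfl).elim⟩,
    by simp [Set.iInter_const], by simp, by simp,
    fun _ => ⟨hK, h0, h1, h.mono fun x hx _ => hx⟩⟩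

end LocalSymmetry

end

theorem mainTheorem4 (N : ℕ) {H : Type*} [NormedAddCommGroup H] [InnerProductSpace ℂ H]
    [CompleteSpace H] [TopologicalSpace.SeparableSpace H]
    (G : LocalSymmetry.Space N → ClosedSubmodule ℂ H)
    (hmeas : ∀ v : H, AEStronglyMeasurable (fun x => LocalSymmetry.proj (G x) v) volume)
    (𝒦 : Set (ClosedSubmodule ℂ H)) (h𝒦 : ∀ᵐ x, G x ∈ 𝒦)
    (hsymm : LocalSymmetry.IsGlobalSymmetry (LocalSymmetry.H1 N H) LocalSymmetry.laplaceForm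
      (LocalSymmetry.expGroup (LocalSymmetry.localSubspace G)).range) :
    LocalSymmetry.IsLocallyConstant 𝒦 (fun x => LocalSymmetry.proj (G x)) := by
  -- The constant subspace is taken to be an actual fibre `G x₀`, chosen where `G x₀ ∈ 𝒦`.
  obtain ⟨x₀, hx₀, hmem⟩ := ((LocalSymmetry.ae_proj_eq hmeas hsymm).and h𝒦).exists
  exact LocalSymmetry.isLocallyConstant_of_ae_eq hmem hx₀
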